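/- Let $E$ be a finite set with $n$ elements. Let $\mathcal M^1=(E,\mathcal I^1)$ and $\mathcal M^2=(E,\mathcal I^2)$ (the *clean* matroids) be partition matroids: for each of them, $E$ is partitioned into classes $C$ with capacities $k_C\in\mathbb Z_{\ge 0}$, and a set $S\subseteq E$ is independent if and only if $|C\cap S|\le k_C$ for every class $C$. Let $\mathcal M^1_d=(E,\mathcal I^1_d)$ and $\mathcal M^2_d=(E,\mathcal I^2_d)$ (the *dirty* matroids) be matroids with $\mathcal I^1\subseteq\mathcal I^1_d$ and $\mathcal I^2\subseteq\mathcal I^2_d$. Put $\eta_i=|\mathcal I^i_d\setminus\mathcal I^i|$ for $i=1,2$, and let $r$ be the minimum of the ranks of $\mathcal M^1$ and $\mathcal M^2$. We consider deterministic adaptive algorithms (decision trees) that know $E$ and access the four matroids only through independence oracles; the algorithm does not depend on the matroids (nor on their classes and capacities, nor on $\eta_1,\eta_2,r$). Only calls to the independence oracles of the clean matroids are counted. We set $\lceil\log_2 0\rceil:=0$. 1. There is an algorithm that, given in addition a set $X\in\mathcal I^1\cap\mathcal I^2$, either returns a set in $\mathcal I^1\cap\mathcal I^2$ of cardinality $|X|+1$,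 or correctly reports that $X$ has maximum cardinality in $\mathcal I^1\cap\mathcal I^2$, and that uses at most $2+(\eta_1+\eta_2)(\lceil\log_2 n\rceil+2)$ clean-oracle calls. 2. There is an algorithm that computes a set of maximum cardinality in $\mathcal I^1\cap\mathcal I^2$ using at most $(r+1)\bigl(2+(\eta_1+\eta_2)(\lceil\log_2 n\rceil+2)\bigr)$ clean-oracle calls. -/

import Mathlib

/-- A matroid on the finite ground set `E` is a *partition matroid* if the elements of `E` are
partitioned into classes `C` with capacities `k C` and a set is independent if and only if
it contains at most `k C` elements of each class `C`. -/
def IsPartitionMatroid {E : Type*} [Fintype E] [DecidableEq E] (M : Matroid E) : Prop :=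
  M.E = Set.univ ∧
    ∃ (P : Finpartition (Finset.univ : Finset E)) (k : Finset E → ℕ),
      ∀ S : Finset E, M.Indep (S : Set E) ↔ ∀ C ∈ P.parts, (C ∩ S).card ≤ k C

/-- Deterministic adaptive algorithms in the two-oracle model for a pair of matroids on `E`, as
decision trees. A node is either a final output, or an independence query "is `F` independent in
matroid number `i`?" to the dirty or to the clean oracle, followed by a continuation that
depends on the answer. The tree itself knows neither the clean nor the dirty matroids: it learns
about them only through the answers. -/
inductive TwoOracleAlg (E : Type*) (β : Type*) where
  | output (b : β) : TwoOracleAlg E β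
  | dirtyQuery (i : Fin 2) (F : Finset E) (next : Bool → TwoOracleAlg E β) : TwoOracleAlg E β
  | cleanQuery (i : Fin 2) (F : Finset E) (next : Bool → TwoOracleAlg E β) : TwoOracleAlg E β

namespace TwoOracleAlg

open Classical in
/-- The output of an algorithm on the instance with clean matroids `M 0, M 1` and dirty matroids
`Md 0, Md 1`. -/
noncomputable def run {E β : Type*} (M Md : Fin 2 → Matroid E) : TwoOracleAlg E β → β
  | output b => b
  | dirtyQuery i F next => run M Md (next (decide ((Md i).Indep (F : Set E))))
  | cleanQuery i F next => run M Md (next (decide ((M i).Indep (F : Set E))))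

open Classical in
/-- The number of clean-oracle calls of an algorithm on the instance with clean matroids
`M 0, M 1` and dirty matroids `Md 0, Md 1`; dirty-oracle calls are free. -/
noncomputable def cleanCalls {E β : Type*} (M Md : Fin 2 → Matroid E) : TwoOracleAlg E β → ℕ
  | output _ => 0
  | dirtyQuery i F next => cleanCalls M Md (next (decide ((Md i).Indep (F : Set E))))
  | cleanQuery i F next => cleanCalls M Md (next (decide ((M i).Indep (F : Set E)))) + 1

end TwoOracleAlg

/-- Feasible solutions of the matroid intersection problem. -/
def CommonIndep {E : Type*} (M : Fin 2 → Matroid E) (X : Finset E) : Prop :=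
  ∀ i, (M i).Indep (X : Set E)

/-- Optimum solutions of the matroid intersection problem. -/
def IsMaxCommonIndep {E : Type*} (M : Fin 2 → Matroid E) (X : Finset E) : Prop :=
  CommonIndep M X ∧ ∀ Y : Finset E, CommonIndep M Y → Y.card ≤ X.card

/-- An instance: the clean matroids are partition matroids on `E`, and the dirty matroids are
matroids on `E` in which every set that is independent in the clean matroid is independent. -/
structure IsInstance {E : Type*} [Fintype E] [DecidableEq E] (M Md : Fin 2 → Matroid E) :
    Prop where
  partition : ∀ i, IsPartitionMatroid (M i)
  dirty_ground : ∀ i, (Md i).E = Set.univ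
  superset : ∀ i (F : Finset E), (M i).Indep (F : Set E) → (Md i).Indep (F : Set E)

/-- The error of matroid number `i`: the number of sets that are independent in the dirty
matroid but not in the clean one. -/
noncomputable def eta {E : Type*} (M Md : Fin 2 → Matroid E) (i : Fin 2) : ℕ :=
  {F : Finset E | (Md i).Indep (F : Set E) ∧ ¬ (M i).Indep (F : Set E)}.ncard

/-- The smaller one of the ranks of the two clean matroids. -/
noncomputable def minRank {E : Type*} (M : Fin 2 → Matroid E) : ℕ :=
  min (M 0).eRank.toNat (M 1).eRank.toNat

/-- The bound `2 + (η₁ + η₂) (⌈log₂ n⌉ + 2)` where `n` is the number of elements of `E`. -/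
noncomputable def stepBound {E : Type*} [Fintype E] (M Md : Fin 2 → Matroid E) : ℕ :=
  2 + (eta M Md 0 + eta M Md 1) * (⌈Real.logb 2 (Fintype.card E)⌉₊ + 2)

/-!
The dirty oracles are free, so an algorithm may start from the family of all dirty independent
sets, which contains the clean independent sets and exceeds them by `η₁ + η₂` faults in total. In
the exchange graph of such a family, either there is no augmenting path, and then `X` is maximum
because the graph contains the exchange graph of the clean matroids, or there is a shortest one.
Two clean calls tell whether its target is a clean common independent set. If it is not, perform
the exchanges of the path one by one: the intermediate sets start with `X` and end with the target,
so binary search finds an exchange that destroys clean independence. Exchangeability in a partition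
matroid depends only on the classes of the two elements, so this exchange already fails at `X`, and
the set tested by its arc is a fault, which is discarded from the family before trying again.
-/

namespace TwoOracleAlg

variable {E β γ : Type*} {M Md : Fin 2 → Matroid E}

/-- Sequential composition: run an algorithm and continue with one that depends on its output. -/
def bind : TwoOracleAlg E β → (β → TwoOracleAlg E γ) → TwoOracleAlg E γ
  | output b, g => g b
  | dirtyQuery i F next, g => dirtyQuery i F fun b => (next b).bind g
  | cleanQuery i F next, g => cleanQuery i F fun b => (next b).bind g

theorem run_bind (a : TwoOracleAlg E β) (g : β → TwoOracleAlg E γ) :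
    (a.bind g).run M Md = (g (a.run M Md)).run M Md := by
  induction a with
  | output => rfl
  | dirtyQuery _ _ _ ih => exact ih _
  | cleanQuery _ _ _ ih => exact ih _

theorem cleanCalls_bind (a : TwoOracleAlg E β) (g : β → TwoOracleAlg E γ) :
    (a.bind g).cleanCalls M Md = a.cleanCalls M Md + (g (a.run M Md)).cleanCalls M Md := by
  induction a with
  | output => exact (Nat.zero_add _).symm
  | dirtyQuery _ _ _ ih => exact ih _
  | cleanQuery _ _ _ ih => simp only [bind, run, cleanCalls, ih, Nat.add_right_comm]

/-- Binary search for an `m` in `[lo, hi)` such that `Z m` is independent in the clean matroid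
number `i` and `Z (m + 1)` is not, given that `Z lo` is independent and `Z hi` is not. -/
def binarySearch (i : Fin 2) (Z : ℕ → Finset E) (lo hi : ℕ) : TwoOracleAlg E ℕ :=
  if lo + 1 < hi then
    cleanQuery i (Z ((lo + hi) / 2)) fun b =>
      if b then binarySearch i Z ((lo + hi) / 2) hi else binarySearch i Z lo ((lo + hi) / 2)
  else output lo
termination_by hi - lo

theorem run_binarySearch {i : Fin 2} {Z : ℕ → Finset E} {lo hi : ℕ}
    (hlo : (M i).Indep (Z lo : Set E)) (hhi : ¬ (M i).Indep (Z hi : Set E)) (hlt : lo < hi) :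
    (binarySearch i Z lo hi).run M Md < hi ∧
      (M i).Indep (Z ((binarySearch i Z lo hi).run M Md) : Set E) ∧
      ¬ (M i).Indep (Z ((binarySearch i Z lo hi).run M Md + 1) : Set E) := by
  induction lo, hi using binarySearch.induct with
  | case1 lo hi h ih_upper ih_lower =>
    rw [binarySearch, if_pos h]
    by_cases hmid : (M i).Indep (Z ((lo + hi) / 2) : Set E)
    · simpa only [run, hmid, decide_true, if_true] using ih_upper hmid hhi (by omega)
    · obtain ⟨hm, hrun⟩ := ih_lower hlo hmid (by omega)
      simpa only [run, hmid, decide_false, Bool.false_eq_true, if_false] using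
        And.intro (hm.trans (by omega)) hrun
  | case2 lo hi h =>
    obtain rfl : hi = lo + 1 := by omega
    rw [binarySearch, if_neg h]
    exact ⟨hlt, hlo, hhi⟩

theorem cleanCalls_binarySearch_le (i : Fin 2) (Z : ℕ → Finset E) (lo hi : ℕ) :
    (binarySearch i Z lo hi).cleanCalls M Md ≤ Nat.clog 2 (hi - lo) := by
  induction lo, hi using binarySearch.induct with
  | case1 lo hi h ih_upper ih_lower =>
    rw [binarySearch, if_pos h, cleanCalls, Nat.clog_of_two_le one_lt_two (by omega)]
    refine Nat.succ_le_succ ?_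
    split_ifs
    · exact ih_upper.trans (Nat.clog_mono_right 2 (by omega))
    · exact ih_lower.trans (Nat.clog_mono_right 2 (by omega))
  | case2 lo hi h =>
    rw [binarySearch, if_neg h]
    exact Nat.zero_le _

/-- Query the dirty oracles for all pairs in a list, and output the pairs `(i, F)` for which `F`
is independent in the dirty matroid number `i`. -/
def collectDirty [DecidableEq E] :
    List (Fin 2 × Finset E) → TwoOracleAlg E (Finset (Fin 2 × Finset E))
  | [] => output ∅
  | q :: l => dirtyQuery q.1 q.2 fun b =>
      (collectDirty l).bind fun C => output (if b then insert q C else C)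

open Classical in
theorem run_collectDirty [DecidableEq E] (l : List (Fin 2 × Finset E)) :
    (collectDirty l).run M Md = {q ∈ l.toFinset | (Md q.1).Indep (q.2 : Set E)} := by
  induction l with
  | nil => rfl
  | cons q l ih =>
    rw [collectDirty, run, run_bind, ih, run, List.toFinset_cons, Finset.filter_insert]
    simp only [decide_eq_true_eq]

theorem cleanCalls_collectDirty [DecidableEq E] (l : List (Fin 2 × Finset E)) :
    (collectDirty l).cleanCalls M Md = 0 := by
  induction l with
  | nil => rfl
  | cons q l ih => rw [collectDirty, cleanCalls, cleanCalls_bind, ih, cleanCalls]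

end TwoOracleAlg

/-- `u 0, …, u k` is a walk from `S` to `T` in the directed graph `r`; the values of `u` beyond
`k` are irrelevant. -/
structure IsWalk {V : Type*} (r : V → V → Prop) (S T : Set V) (k : ℕ) (u : ℕ → V) : Prop where
  start_mem : u 0 ∈ S
  end_mem : u k ∈ T
  step : ∀ j < k, r (u j) (u (j + 1))

/-- A walk from `S` to `T` of minimum length. -/
structure IsShortestWalk {V : Type*} (r : V → V → Prop) (S T : Set V) (k : ℕ) (u : ℕ → V) : Prop
    extends IsWalk r S T k u where
  le_length : ∀ l v, IsWalk r S T l v → k ≤ l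

section Walk

variable {V : Type*} {r : V → V → Prop} {S T : Set V} {k : ℕ} {u : ℕ → V}

theorem exists_isWalk_of_reflTransGen {s t : V} (h : Relation.ReflTransGen r s t) (ht : t ∈ T) :
    ∃ k u, IsWalk r {s} T k u := by
  induction h using Relation.ReflTransGen.head_induction_on with
  | refl => exact ⟨0, fun _ => t, rfl, ht, by simp⟩
  | @head a b hab _ ih =>
    obtain ⟨k, u, h0, hk, hstep⟩ := ih
    refine ⟨k + 1, fun | 0 => a | n + 1 => u n, rfl, hk, ?_⟩
    rintro (_ | j) hj
    · rwa [← Set.mem_singleton_iff.1 h0] at hab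
    · exact hstep j (by omega)

theorem exists_isShortestWalk (h : ∃ k u, IsWalk r S T k u) : ∃ k u, IsShortestWalk r S T k u := by
  classical
  obtain ⟨u, hu⟩ := Nat.find_spec h
  exact ⟨Nat.find h, u, hu, fun l v hv => Nat.find_min' h ⟨v, hv⟩⟩

namespace IsWalk

theorem take (h : IsWalk r S T k u) {i : ℕ} (hik : i ≤ k) (hi : u i ∈ T) : IsWalk r S T i u :=
  ⟨h.start_mem, hi, fun j hj => h.step j (by omega)⟩

theorem drop (h : IsWalk r S T k u) {i : ℕ} (hik : i ≤ k) (hi : u i ∈ S) :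
    IsWalk r S T (k - i) fun n => u (i + n) :=
  ⟨hi, by simpa only [Nat.add_sub_cancel' hik] using h.end_mem,
    fun j _ => h.step (i + j) (by omega)⟩

theorem shortcut (h : IsWalk r S T k u) {i j : ℕ} (hik : i ≤ k) (hjk : j ≤ k)
    (hij : r (u i) (u j)) :
    IsWalk r S T (i + 1 + (k - j)) fun n => if n ≤ i then u n else u (n - (i + 1) + j) := by
  refine ⟨by simpa using h.start_mem, ?_, fun n hn => ?_⟩
  · rw [if_neg (by omega), show i + 1 + (k - j) - (i + 1) + j = k by omega]
    exact h.end_mem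
  · rcases lt_trichotomy n i with hni | rfl | hin
    · simpa only [hni.le, Nat.succ_le_of_lt hni, if_true] using h.step n (by omega)
    · simpa using hij
    · simp only [hin.not_ge, show ¬ n + 1 ≤ i by omega, if_false,
        show n + 1 - (i + 1) + j = n - (i + 1) + j + 1 by omega]
      exact h.step _ (by omega)

end IsWalk

namespace IsShortestWalk

theorem notMem_end (h : IsShortestWalk r S T k u) {j : ℕ} (hj : j < k) : u j ∉ T := fun hjT =>
  hj.not_ge (h.le_length _ _ (h.take hj.le hjT))

theorem notMem_start (h : IsShortestWalk r S T k u) {j : ℕ} (hj : 0 < j) (hjk : j ≤ k) :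
    u j ∉ S := fun hjS => by
  have := h.le_length _ _ (h.drop hjk hjS)
  omega

theorem le_succ_of_rel (h : IsShortestWalk r S T k u) {i j : ℕ} (hik : i ≤ k) (hjk : j ≤ k)
    (hij : r (u i) (u j)) : j ≤ i + 1 := by
  have := h.le_length _ _ (h.shortcut hik hjk hij)
  omega

theorem injOn (h : IsShortestWalk r S T k u) : Set.InjOn u (Set.Iic k) := by
  have ne_of_lt : ∀ {i j}, i < j → j ≤ k → u i ≠ u j := by
    intro i j hij hjk heq
    rcases hjk.lt_or_eq with hjk | rfl
    · have := h.le_succ_of_rel (hij.trans hjk).le hjk (heq ▸ h.step j hjk)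
      omega
    · exact h.notMem_end hij (heq ▸ h.end_mem)
  intro i hi j hj heq
  by_contra hne
  rcases Nat.lt_or_gt_of_ne hne with hlt | hlt
  · exact ne_of_lt hlt hj heq
  · exact ne_of_lt hlt hi heq.symm

end IsShortestWalk

end Walk

/-- Partition matroids described by labels instead of classes: a set is independent if and only if
it has at most `k c` elements with label `c`, for each `c`. -/
def HasCapacities {E ι : Type*} [DecidableEq ι] (M : Matroid E) (f : E → ι) (k : ι → ℕ) : Prop :=
  ∀ S : Finset E, M.Indep (S : Set E) ↔ ∀ c, {s ∈ S | f s = c}.card ≤ k c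

section Matroid

variable {E ι : Type*} [DecidableEq E] [DecidableEq ι] {M : Matroid E} {f : E → ι} {k : ι → ℕ}
  {X Y Z : Finset E} {u w : E}

theorem IsPartitionMatroid.exists_hasCapacities [Fintype E] (h : IsPartitionMatroid M) :
    ∃ (f : E → Finset E) (k : Finset E → ℕ), HasCapacities M f k := by
  obtain ⟨_, P, k, hk⟩ := h
  have inter_eq : ∀ C ∈ P.parts, ∀ S : Finset E, C ∩ S = {s ∈ S | P.part s = C} := by
    intro C hC S
    ext s
    rw [Finset.mem_inter, Finset.mem_filter, P.part_eq_iff_mem hC, and_comm]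
  refine ⟨P.part, k, fun S => (hk S).trans ⟨fun h c => ?_, fun h C hC => inter_eq C hC S ▸ h C⟩⟩
  by_cases hc : c ∈ P.parts
  · exact inter_eq c hc S ▸ h c hc
  · rw [Finset.filter_false_of_mem, Finset.card_empty]
    · exact Nat.zero_le _
    · rintro s _ rfl
      exact hc (P.part_mem.2 (Finset.mem_univ s))

theorem HasCapacities.indep_insert_erase (h : HasCapacities M f k) (hZ : M.Indep (Z : Set E))
    (hw : w ∈ Z) (hwu : f w = f u) : M.Indep (insert u (Z.erase w) : Finset E) := by
  refine (h _).2 fun c => le_trans ?_ ((h Z).1 hZ c)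
  rw [Finset.filter_insert, Finset.filter_erase]
  split_ifs with hc
  · have hw' : w ∈ ({s ∈ Z | f s = c} : Finset E) := Finset.mem_filter.2 ⟨hw, hwu.trans hc⟩
    exact (Finset.card_insert_le _ _).trans_eq (Finset.card_erase_add_one hw')
  · exact Finset.card_le_card (Finset.erase_subset _ _)

theorem HasCapacities.label_eq_of_indep_insert_erase (h : HasCapacities M f k)
    (hX : M.Indep (X : Set E)) (hu : ¬ M.Indep (insert u X : Finset E))
    (huw : M.Indep (insert u (X.erase w) : Finset E)) : f w = f u := by
  by_contra hne
  refine hu ((h _).2 fun c => ?_)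
  rw [Finset.filter_insert]
  split_ifs with hc
  · subst hc
    have := (h _).1 huw (f u)
    rwa [Finset.filter_insert, if_pos rfl, Finset.filter_erase,
      Finset.erase_eq_of_notMem (by simp [hne])] at this
  · exact (h X).1 hX c

-- Exchangeability only depends on the classes of `u` and `w`, so it carries over from `X` to `Z`.
theorem IsPartitionMatroid.indep_insert_erase [Fintype E] (h : IsPartitionMatroid M)
    (hX : M.Indep (X : Set E)) (hu : ¬ M.Indep (insert u X : Finset E))
    (huw : M.Indep (insert u (X.erase w) : Finset E)) (hZ : M.Indep (Z : Set E)) (hw : w ∈ Z) :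
    M.Indep (insert u (Z.erase w) : Finset E) := by
  obtain ⟨f, k, hM⟩ := h.exists_hasCapacities
  exact hM.indep_insert_erase hZ hw (hM.label_eq_of_indep_insert_erase hX hu huw)

theorem exists_exchange_of_card_filter_lt (p : E → Prop) [DecidablePred p]
    (hX : M.Indep (X : Set E)) (hY : M.Indep (Y : Set E))
    (hlt : {x ∈ X | p x}.card < {y ∈ Y | p y}.card) :
    ∃ y ∉ X, p y ∧ (M.Indep (insert y X : Finset E) ∨
      ∃ x ∈ X, ¬ p x ∧ M.Indep (insert y (X.erase x) : Finset E)) := by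
  obtain ⟨y, ⟨hyY, hyX⟩, hy⟩ :=
    (hX.subset (Finset.coe_subset.2 (Finset.filter_subset p X))).augment
      (hY.subset (Finset.coe_subset.2 (Finset.filter_subset p Y))) (by
        simpa only [Set.encard_coe_eq_coe_finsetCard, Nat.cast_lt] using hlt)
  rw [Finset.mem_coe, Finset.mem_filter] at hyY hyX
  have hyX : y ∉ X := fun h => hyX ⟨h, hyY.2⟩
  refine ⟨y, hyX, hyY.2, or_iff_not_imp_left.2 fun hdep => ?_⟩
  rw [Finset.coe_insert] at hdep
  have hcl : y ∈ M.closure X :=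
    hX.mem_closure_iff'.2 ⟨hY.subset_ground hyY.1, fun h => absurd h hdep⟩
  obtain ⟨x, hxC, hx⟩ : ∃ x ∈ M.fundCircuit y X, x ∉ insert y (↑{x ∈ X | p x} : Set E) :=
    Set.not_subset.1 fun hsub => (hX.fundCircuit_isCircuit hcl hyX).not_indep (hy.subset hsub)
  obtain ⟨hxy, hxp⟩ : x ≠ y ∧ ¬ (x ∈ X ∧ p x) := by simpa [not_or] using hx
  have hxX : x ∈ X := (M.fundCircuit_subset_insert y X hxC).resolve_left hxy
  refine ⟨x, hxX, fun h => hxp ⟨hxX, h⟩, ?_⟩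
  rw [← Finset.erase_insert_of_ne hxy.symm, Finset.coe_erase, Finset.coe_insert]
  exact (hX.mem_fundCircuit_iff hcl hyX).1 hxC

end Matroid

/-- The set tested by arc number `m` of the exchange sequence at `X` that adds `u 0` and then, for
each `j`, replaces `w j` with `u (j + 1)`. -/
def arcSet {E : Type*} [DecidableEq E] (X : Finset E) (u w : ℕ → E) : ℕ → Finset E
  | 0 => insert (u 0) X
  | j + 1 => insert (u (j + 1)) (X.erase (w j))

/-- The result of performing simultaneously the exchanges of the first `m` arcs at `X`. Only
`m - 1` of them remove an element; the truncated subtraction makes this right for `m = 0`. -/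
def prefixExchange {E : Type*} [DecidableEq E] (X : Finset E) (u w : ℕ → E) (m : ℕ) : Finset E :=
  X \ (Finset.range (m - 1)).image w ∪ (Finset.range m).image u

/-- A shortcut-free sequence of `k + 1` arcs at `X` for one set family `J`, as it arises from a
shortest augmenting path: the elements are distinct, all arcs are in `J`, and no element but the
first can be added to `X` in `J`. -/
structure IsExchangeSeq {E : Type*} [DecidableEq E] (J : Finset E → Prop) (X : Finset E) (k : ℕ)
    (u w : ℕ → E) : Prop where
  notMem : ∀ j ≤ k, u j ∉ X
  mem : ∀ j < k, w j ∈ X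
  injOn_added : Set.InjOn u (Set.Iic k)
  injOn_removed : Set.InjOn w (Set.Iio k)
  arc : ∀ m ≤ k, J (arcSet X u w m)
  not_insert : ∀ j < k, ¬ J (insert (u (j + 1)) X)

namespace IsExchangeSeq

variable {E : Type*} [DecidableEq E] {J : Finset E → Prop} {X : Finset E} {k : ℕ} {u w : ℕ → E}

theorem length_lt_card [Fintype E] (h : IsExchangeSeq J X k u w) : k < Fintype.card E := by
  have hcard := Finset.card_le_univ ((Finset.Iic k).image u)
  rwa [Finset.card_image_of_injOn (by simpa using h.injOn_added), Nat.card_Iic] at hcard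

theorem card_prefixExchange (h : IsExchangeSeq J X k u w) :
    (prefixExchange X u w (k + 1)).card = X.card + 1 := by
  have hsub : (Finset.range k).image w ⊆ X :=
    Finset.image_subset_iff.2 fun j hj => h.mem j (Finset.mem_range.1 hj)
  have hdisj : Disjoint (X \ (Finset.range k).image w) ((Finset.range (k + 1)).image u) := by
    refine Finset.disjoint_right.2 fun x hx hxX => ?_
    obtain ⟨j, hj, rfl⟩ := Finset.mem_image.1 hx
    exact h.notMem j (Finset.mem_range_succ_iff.1 hj) (Finset.mem_sdiff.1 hxX).1
  have hadded : ((Finset.range (k + 1)).image u).card = k + 1 := by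
    rw [Finset.card_image_of_injOn (h.injOn_added.mono fun j hj => Finset.mem_range_succ_iff.1 hj),
      Finset.card_range]
  have hremoved : ((Finset.range k).image w).card = k := by
    rw [Finset.card_image_of_injOn (h.injOn_removed.mono fun j hj => Finset.mem_range.1 hj),
      Finset.card_range]
  have hle := Finset.card_le_card hsub
  rw [prefixExchange, Nat.add_sub_cancel, Finset.card_union_of_disjoint hdisj,
    Finset.card_sdiff_of_subset hsub, hadded, hremoved]
  omega

theorem removed_mem_prefixExchange (h : IsExchangeSeq J X k u w) {j : ℕ} (hj : j < k) :
    w j ∈ prefixExchange X u w (j + 1) := by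
  refine Finset.mem_union_left _ (Finset.mem_sdiff.2 ⟨h.mem j hj, fun hmem => ?_⟩)
  obtain ⟨i, hi, heq⟩ := Finset.mem_image.1 hmem
  have hij : i < j := Finset.mem_range.1 hi
  exact hij.ne (h.injOn_removed (hij.trans hj) hj heq)

theorem prefixExchange_succ (h : IsExchangeSeq J X k u w) {j : ℕ} (hj : j < k) :
    prefixExchange X u w (j + 2) =
      insert (u (j + 1)) ((prefixExchange X u w (j + 1)).erase (w j)) := by
  have hw : w j ∉ (Finset.range (j + 1)).image u := fun hmem => by
    obtain ⟨i, hi, heq⟩ := Finset.mem_image.1 hmem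
    exact h.notMem i ((Finset.mem_range_succ_iff.1 hi).trans hj.le) (heq ▸ h.mem j hj)
  simp only [prefixExchange, Nat.add_sub_cancel, show j + 2 - 1 = j + 1 from rfl]
  rw [Finset.erase_union_distrib, Finset.erase_eq_of_notMem hw, ← Finset.sdiff_insert,
    ← Finset.image_insert, ← Finset.range_add_one, Finset.range_add_one (n := j + 1),
    Finset.image_insert, Finset.union_insert]

theorem indep_prefixExchange_succ [Fintype E] {M : Matroid E} (hM : IsPartitionMatroid M)
    (h : IsExchangeSeq J X k u w) (hJ : ∀ F : Finset E, M.Indep (F : Set E) → J F)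
    (hX : M.Indep (X : Set E)) {m : ℕ} (hm : m ≤ k)
    (hprefix : M.Indep (prefixExchange X u w m : Set E))
    (harc : M.Indep (arcSet X u w m : Set E)) :
    M.Indep (prefixExchange X u w (m + 1) : Set E) := by
  cases m with
  | zero => simpa [prefixExchange, arcSet] using harc
  | succ j =>
    rw [h.prefixExchange_succ hm]
    exact hM.indep_insert_erase hX (fun hi => h.not_insert j hm (hJ _ hi)) harc hprefix
      (h.removed_mem_prefixExchange hm)

end IsExchangeSeq

section ExchangeGraph

variable {E : Type*} [DecidableEq E] {J : Fin 2 → Finset E → Prop} {X : Finset E} {k : ℕ}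
  {u w : ℕ → E}

/-- Two consecutive arcs `z → x → y` of the exchange graph at `X` for the set families `J 0` and
`J 1`, with `x` in `X` and `y` outside. -/
def ExchangeStep (J : Fin 2 → Finset E → Prop) (X : Finset E) (z y : E) : Prop :=
  y ∉ X ∧ ∃ x ∈ X, J 1 (insert z (X.erase x)) ∧ J 0 (insert y (X.erase x))

/-- The elements that can be added to `X` in `J 0`, where augmenting paths start. -/
def exchangeSources (J : Fin 2 → Finset E → Prop) (X : Finset E) : Set E :=
  {y | y ∉ X ∧ J 0 (insert y X)}

/-- The elements that can be added to `X` in `J 1`, where augmenting paths end. -/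
def exchangeSinks (J : Fin 2 → Finset E → Prop) (X : Finset E) : Set E :=
  {y | J 1 (insert y X)}

-- The proof is by Edmonds' cut: the set `p` of reachable elements satisfies `|Y ∩ p| ≤ |X ∩ p|`
-- by exchanges in `M 1` and `|Y \ p| ≤ |X \ p|` by exchanges in `M 0`.
theorem isMaxCommonIndep_of_not_exists_isWalk {M : Fin 2 → Matroid E} (hX : CommonIndep M X)
    (hJ : ∀ i (F : Finset E), (M i).Indep (F : Set E) → J i F)
    (hno : ¬ ∃ k u, IsWalk (ExchangeStep J X) (exchangeSources J X) (exchangeSinks J X) k u) :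
    IsMaxCommonIndep M X := by
  classical
  let Reachable (y : E) : Prop :=
    ∃ s ∈ exchangeSources J X, Relation.ReflTransGen (ExchangeStep J X) s y
  have notMem_sinks : ∀ {y}, Reachable y → y ∉ exchangeSinks J X := by
    rintro y ⟨s, hs, hsy⟩ hy
    obtain ⟨k, u, hu⟩ := exists_isWalk_of_reflTransGen hsy hy
    exact hno ⟨k, u, Set.mem_singleton_iff.1 hu.start_mem ▸ hs, hu.end_mem, hu.step⟩
  have notMem : ∀ {y}, Reachable y → y ∉ X := by
    rintro y ⟨s, hs, hsy⟩
    rcases hsy.cases_tail with rfl | ⟨z, _, hzy⟩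
    exacts [hs.1, hzy.1]
  let p (v : E) : Prop := Reachable v ∨ v ∈ X ∧ ∃ z, Reachable z ∧ J 1 (insert z (X.erase v))
  refine ⟨hX, fun Y hY => ?_⟩
  have hin : {y ∈ Y | p y}.card ≤ {x ∈ X | p x}.card := by
    by_contra! hlt
    obtain ⟨y, hyX, hy | ⟨hyX', _⟩, hadd | ⟨x, hxX, hx, hexch⟩⟩ :=
      exists_exchange_of_card_filter_lt p (hX 1) (hY 1) hlt
    · exact notMem_sinks hy (hJ 1 _ hadd)
    · exact hx (Or.inr ⟨hxX, y, hy, hJ 1 _ hexch⟩)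
    all_goals exact hyX hyX'
  have hout : {y ∈ Y | ¬ p y}.card ≤ {x ∈ X | ¬ p x}.card := by
    by_contra! hlt
    obtain ⟨y, hyX, hy, hadd | ⟨x, hxX, hx, hexch⟩⟩ :=
      exists_exchange_of_card_filter_lt (fun v => ¬ p v) (hX 0) (hY 0) hlt
    · exact hy (Or.inl ⟨y, ⟨hyX, hJ 0 _ hadd⟩, .refl⟩)
    · obtain hx | ⟨_, z, ⟨s, hs, hsz⟩, hz⟩ := not_not.1 hx
      · exact notMem hx hxX
      · exact hy (Or.inl ⟨s, hs, hsz.tail ⟨hyX, x, hxX, hz, hJ 0 _ hexch⟩⟩)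
  rw [← Finset.card_filter_add_card_filter_not (s := Y) p,
    ← Finset.card_filter_add_card_filter_not (s := X) p]
  exact Nat.add_le_add hin hout

/-- A shortcut-free augmenting path at `X` for the families `J 0` and `J 1`, recorded as two
exchange sequences: number `0` follows the path and number `1` follows it backwards. -/
structure AugmentingPath (J : Fin 2 → Finset E → Prop) (X : Finset E) where
  length : ℕ
  added : Fin 2 → ℕ → E
  removed : Fin 2 → ℕ → E
  target : Finset E
  isExchangeSeq : ∀ i, IsExchangeSeq (J i) X length (added i) (removed i)
  prefixExchange_eq : ∀ i, prefixExchange X (added i) (removed i) (length + 1) = target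

theorem IsWalk.notMem_of_exchangeStep
    (h : IsWalk (ExchangeStep J X) (exchangeSources J X) (exchangeSinks J X) k u) {j : ℕ}
    (hj : j ≤ k) : u j ∉ X := by
  cases j with
  | zero => exact h.start_mem.1
  | succ j => exact (h.step j hj).1

theorem IsShortestWalk.injOn_removed
    (h : IsShortestWalk (ExchangeStep J X) (exchangeSources J X) (exchangeSinks J X) k u)
    (hw : ∀ j < k, w j ∈ X ∧ J 1 (insert (u j) (X.erase (w j))) ∧
      J 0 (insert (u (j + 1)) (X.erase (w j)))) :
    Set.InjOn w (Set.Iio k) := by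
  have le_of_eq : ∀ {i j}, i < k → j < k → w i = w j → j ≤ i := by
    intro i j hi hj heq
    have hstep : ExchangeStep J X (u i) (u (j + 1)) :=
      ⟨h.notMem_of_exchangeStep hj, w i, (hw i hi).1, (hw i hi).2.1, heq ▸ (hw j hj).2.2⟩
    have := h.le_succ_of_rel hi.le hj hstep
    omega
  exact fun i hi j hj heq => (le_of_eq hj hi heq.symm).antisymm (le_of_eq hi hj heq)

theorem IsShortestWalk.isExchangeSeq
    (h : IsShortestWalk (ExchangeStep J X) (exchangeSources J X) (exchangeSinks J X) k u)
    (hw : ∀ j < k, w j ∈ X ∧ J 1 (insert (u j) (X.erase (w j))) ∧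
      J 0 (insert (u (j + 1)) (X.erase (w j)))) :
    IsExchangeSeq (J 0) X k u w where
  notMem j hj := h.notMem_of_exchangeStep hj
  mem j hj := (hw j hj).1
  injOn_added := h.injOn
  injOn_removed := h.injOn_removed hw
  arc m hm := by
    cases m with
    | zero => exact h.start_mem.2
    | succ j => exact (hw j hm).2.2
  not_insert j hj hJ := h.notMem_start j.succ_pos hj ⟨h.notMem_of_exchangeStep hj, hJ⟩

theorem IsShortestWalk.isExchangeSeq_reverse
    (h : IsShortestWalk (ExchangeStep J X) (exchangeSources J X) (exchangeSinks J X) k u)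
    (hw : ∀ j < k, w j ∈ X ∧ J 1 (insert (u j) (X.erase (w j))) ∧
      J 0 (insert (u (j + 1)) (X.erase (w j)))) :
    IsExchangeSeq (J 1) X k (fun j => u (k - j)) (fun j => w (k - 1 - j)) where
  notMem j _ := h.notMem_of_exchangeStep (Nat.sub_le k j)
  mem j hj := (hw (k - 1 - j) (by omega)).1
  injOn_added i hi j hj heq := by
    have := h.injOn (Nat.sub_le k i) (Nat.sub_le k j) heq
    simp only [Set.mem_Iic] at hi hj
    omega
  injOn_removed i hi j hj heq := by
    simp only [Set.mem_Iio] at hi hj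
    have := h.injOn_removed hw (show k - 1 - i < k by omega) (show k - 1 - j < k by omega) heq
    omega
  arc m hm := by
    cases m with
    | zero => exact h.end_mem
    | succ j =>
      have hsub : k - (j + 1) = k - 1 - j := by omega
      simpa only [arcSet, hsub] using (hw (k - 1 - j) (by omega)).2.1
  not_insert j hj := h.notMem_end (by omega)

theorem prefixExchange_reverse (X : Finset E) (u w : ℕ → E) (k : ℕ) :
    prefixExchange X (fun j => u (k - j)) (fun j => w (k - 1 - j)) (k + 1) =
      prefixExchange X u w (k + 1) := by
  have image_reverse : ∀ (v : ℕ → E) (n : ℕ),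
      (Finset.range n).image (fun j => v (n - 1 - j)) = (Finset.range n).image v := fun v n => by
    conv_rhs => rw [← Finset.range_image_pred_top_sub n, Finset.image_image]
    rfl
  exact congrArg₂ (fun A B => X \ A ∪ B) (image_reverse w k) (image_reverse u (k + 1))

theorem nonempty_augmentingPath
    (h : ∃ k u, IsWalk (ExchangeStep J X) (exchangeSources J X) (exchangeSinks J X) k u) :
    Nonempty (AugmentingPath J X) := by
  obtain ⟨k, u, hu⟩ := exists_isShortestWalk h
  have : Nonempty E := ⟨u 0⟩
  choose! w hw using fun j hj => (hu.step j hj).2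
  exact ⟨{
    length := k
    added := ![u, fun j => u (k - j)]
    removed := ![w, fun j => w (k - 1 - j)]
    target := prefixExchange X u w (k + 1)
    isExchangeSeq := Fin.forall_fin_two.2 ⟨hu.isExchangeSeq hw, hu.isExchangeSeq_reverse hw⟩
    prefixExchange_eq := Fin.forall_fin_two.2 ⟨rfl, prefixExchange_reverse X u w k⟩ }⟩

end ExchangeGraph

namespace AugmentingPath

open TwoOracleAlg

variable {E : Type*} [DecidableEq E] {J : Fin 2 → Finset E → Prop} {X : Finset E}
  {M Md : Fin 2 → Matroid E}

theorem card_target (P : AugmentingPath J X) : P.target.card = X.card + 1 :=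
  P.prefixExchange_eq 0 ▸ (P.isExchangeSeq 0).card_prefixExchange

/-- Search for an arc of the path that is not independent in the clean matroid number `i`, given
that the target of the path is not independent in it. -/
def searchFault (P : AugmentingPath J X) (i : Fin 2) : TwoOracleAlg E (Fin 2 × Finset E) :=
  (binarySearch i (prefixExchange X (P.added i) (P.removed i)) 0 (P.length + 1)).bind fun m =>
    output (i, arcSet X (P.added i) (P.removed i) m)

/-- Test whether the target of the path is a common independent set of the clean matroids; if it
is not, find a set `F` with `J i F` that is dependent in the clean matroid number `i`, and output
`(i, F)`. -/
def findFault (P : AugmentingPath J X) : TwoOracleAlg E (Option (Fin 2 × Finset E)) :=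
  cleanQuery 0 P.target fun indep₀ =>
    if indep₀ then
      cleanQuery 1 P.target fun indep₁ =>
        if indep₁ then output none else (P.searchFault 1).bind fun q => output (some q)
    else (P.searchFault 0).bind fun q => output (some q)

theorem run_searchFault [Fintype E] (P : AugmentingPath J X) {i : Fin 2}
    (hM : IsPartitionMatroid (M i)) (hJ : ∀ F : Finset E, (M i).Indep (F : Set E) → J i F)
    (hX : (M i).Indep (X : Set E)) (htarget : ¬ (M i).Indep (P.target : Set E)) :
    ∃ F, (P.searchFault i).run M Md = (i, F) ∧ J i F ∧ ¬ (M i).Indep (F : Set E) := by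
  have hseq := P.isExchangeSeq i
  obtain ⟨hlt, hindep, hdep⟩ := run_binarySearch (M := M) (Md := Md)
    (Z := prefixExchange X (P.added i) (P.removed i)) (by simpa [prefixExchange] using hX)
    (P.prefixExchange_eq i ▸ htarget) P.length.succ_pos
  exact ⟨_, run_bind _ _, hseq.arc _ (Nat.le_of_lt_succ hlt), fun harc => hdep
    (hseq.indep_prefixExchange_succ hM hJ hX (Nat.le_of_lt_succ hlt) hindep harc)⟩

theorem cleanCalls_searchFault_le [Fintype E] (P : AugmentingPath J X) (i : Fin 2) :
    (P.searchFault i).cleanCalls M Md ≤ Nat.clog 2 (Fintype.card E) := by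
  rw [searchFault, cleanCalls_bind]
  exact (cleanCalls_binarySearch_le i _ _ _).trans
    (Nat.clog_mono_right 2 (P.isExchangeSeq i).length_lt_card)

theorem findFault_spec [Fintype E] (P : AugmentingPath J X) (hM : ∀ i, IsPartitionMatroid (M i))
    (hJ : ∀ i (F : Finset E), (M i).Indep (F : Set E) → J i F) (hX : CommonIndep M X) :
    (P.findFault.run M Md = none ∧ CommonIndep M P.target ∧ P.findFault.cleanCalls M Md ≤ 2) ∨
    ∃ i F, P.findFault.run M Md = some (i, F) ∧ J i F ∧ ¬ (M i).Indep (F : Set E) ∧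
      P.findFault.cleanCalls M Md ≤ Nat.clog 2 (Fintype.card E) + 2 := by
  by_cases h₀ : (M 0).Indep (P.target : Set E)
  · by_cases h₁ : (M 1).Indep (P.target : Set E)
    · left
      simp [findFault, run, cleanCalls, h₀, h₁, CommonIndep, Fin.forall_fin_two]
    · obtain ⟨F, hrun, hJF, hF⟩ := P.run_searchFault (Md := Md) (hM 1) (hJ 1) (hX 1) h₁
      refine Or.inr ⟨1, F, ?_, hJF, hF, ?_⟩
      · simp [findFault, run, run_bind, h₀, h₁, hrun]
      · simpa [findFault, cleanCalls, cleanCalls_bind, h₀, h₁] using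
          P.cleanCalls_searchFault_le 1
  · obtain ⟨F, hrun, hJF, hF⟩ := P.run_searchFault (Md := Md) (hM 0) (hJ 0) (hX 0) h₀
    refine Or.inr ⟨0, F, ?_, hJF, hF, ?_⟩
    · simp [findFault, run, run_bind, h₀, hrun]
    · simpa [findFault, cleanCalls, cleanCalls_bind, h₀] using
        (P.cleanCalls_searchFault_le 0).trans (Nat.le_succ _)

end AugmentingPath

section Faults

variable {E : Type*} {M : Fin 2 → Matroid E}

open Classical in
/-- The pairs `(i, F)` in `C` for which `F` is not independent in the clean matroid number `i`. -/
noncomputable def faults (M : Fin 2 → Matroid E) (C : Finset (Fin 2 × Finset E)) :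
    Finset (Fin 2 × Finset E) :=
  {q ∈ C | ¬ (M q.1).Indep (q.2 : Set E)}

theorem card_faults_erase [DecidableEq E] {C : Finset (Fin 2 × Finset E)} {q : Fin 2 × Finset E}
    (hq : q ∈ C) (hdep : ¬ (M q.1).Indep (q.2 : Set E)) :
    (faults M (C.erase q)).card + 1 = (faults M C).card := by
  classical
  rw [faults, Finset.filter_erase, ← faults]
  exact Finset.card_erase_add_one (Finset.mem_filter.2 ⟨hq, hdep⟩)

open Classical in
theorem card_faults_dirty [Fintype E] (M Md : Fin 2 → Matroid E) :
    (faults M {q | (Md q.1).Indep (q.2 : Set E)}).card = eta M Md 0 + eta M Md 1 := by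
  have eta_eq : ∀ i, eta M Md i =
      {F : Finset E | (Md i).Indep (F : Set E) ∧ ¬ (M i).Indep (F : Set E)}.toFinset.card :=
    fun i => Set.ncard_eq_toFinset_card' _
  simp only [faults, eta_eq, Finset.filter_filter, Set.toFinset_ofPred, Finset.card_filter,
    ← Finset.univ_product_univ, Finset.sum_product, Fin.sum_univ_two]

end Faults

section Augment

open TwoOracleAlg

variable {E : Type*} [DecidableEq E] {M Md : Fin 2 → Matroid E} {X : Finset E}

/-- `o` is a correct result of an augmentation step at `X`: a common independent set with one
more element, or `none` if `X` is maximum. -/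
def IsAugmentation (M : Fin 2 → Matroid E) (X : Finset E) (o : Option (Finset E)) : Prop :=
  (∃ Y : Finset E, o = some Y ∧ CommonIndep M Y ∧ Y.card = X.card + 1) ∨
    (o = none ∧ IsMaxCommonIndep M X)

open Classical in
/-- Augment `X`, given a set `C` of candidates that contains all pairs `(i, F)` for which `F` is
independent in the clean matroid number `i`. Each failing augmenting path exposes a fault of `C`,
which is discarded. The test `q ∈ C` always succeeds and only ensures termination. -/
noncomputable def augment (X : Finset E) (C : Finset (Fin 2 × Finset E)) :
    TwoOracleAlg E (Option (Finset E)) :=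
  if h : Nonempty (AugmentingPath (fun i F => (i, F) ∈ C) X) then
    h.some.findFault.bind fun
      | none => output (some h.some.target)
      | some q => if _ : q ∈ C then augment X (C.erase q) else output none
  else output none
termination_by C.card
decreasing_by exact Finset.card_erase_lt_of_mem ‹_›

theorem augment_spec [Fintype E] (hM : ∀ i, IsPartitionMatroid (M i)) (hX : CommonIndep M X)
    (C : Finset (Fin 2 × Finset E))
    (hC : ∀ i (F : Finset E), (M i).Indep (F : Set E) → (i, F) ∈ C) :
    IsAugmentation M X ((augment X C).run M Md) ∧ (augment X C).cleanCalls M Md ≤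
      2 + (faults M C).card * (Nat.clog 2 (Fintype.card E) + 2) := by
  induction C using Finset.strongInduction with
  | H C ih =>
  rw [augment]
  split_ifs with hP
  · rw [run_bind, cleanCalls_bind]
    obtain ⟨hrun, htarget, hcalls⟩ | ⟨i, F, hrun, hFC, hF, hcalls⟩ :=
      hP.some.findFault_spec (Md := Md) hM hC hX
    · rw [hrun]
      exact ⟨Or.inl ⟨_, rfl, htarget, hP.some.card_target⟩, hcalls.trans (Nat.le_add_right _ _)⟩
    · have hC' : ∀ i' (F' : Finset E), (M i').Indep (F' : Set E) → (i', F') ∈ C.erase (i, F) :=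
        fun i' F' hF' => Finset.mem_erase.2 ⟨fun heq => by cases heq; exact hF hF', hC i' F' hF'⟩
      obtain ⟨haug, hcalls'⟩ := ih _ (Finset.erase_ssubset hFC) hC'
      simp only [hrun, hFC, dif_pos]
      refine ⟨haug, ?_⟩
      rw [← card_faults_erase hFC hF, Nat.succ_mul]
      omega
  · refine ⟨Or.inr ⟨rfl, ?_⟩, Nat.zero_le _⟩
    exact isMaxCommonIndep_of_not_exists_isWalk hX hC fun h => hP (nonempty_augmentingPath h)

/-- Read off the dirty matroids completely, which is free, and augment `X`. -/
noncomputable def augmentStep [Fintype E] (X : Finset E) : TwoOracleAlg E (Option (Finset E)) :=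
  (collectDirty Finset.univ.toList).bind (augment X)

theorem augmentStep_spec [Fintype E] (h : IsInstance M Md) (hX : CommonIndep M X) :
    IsAugmentation M X ((augmentStep X).run M Md) ∧
      (augmentStep X).cleanCalls M Md ≤ stepBound M Md := by
  classical
  have hlog : ⌈Real.logb 2 (Fintype.card E)⌉₊ = Nat.clog 2 (Fintype.card E) :=
    mod_cast Real.natCeil_logb_natCast 2 (Fintype.card E)
  rw [augmentStep, run_bind, cleanCalls_bind, cleanCalls_collectDirty, zero_add, stepBound, hlog,
    ← card_faults_dirty, run_collectDirty, Finset.toList_toFinset]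
  exact augment_spec h.partition hX _ fun i F hF => by simpa using h.superset i F hF

end Augment

section Iterate

open TwoOracleAlg

variable {E : Type*} {M Md : Fin 2 → Matroid E} {X : Finset E}

/-- Starting from `X`, augment until `step` reports a maximum, but at most `N` times. -/
def augmentRepeatedly (step : Finset E → TwoOracleAlg E (Option (Finset E))) :
    ℕ → Finset E → TwoOracleAlg E (Finset E)
  | 0, X => output X
  | N + 1, X => (step X).bind fun
    | none => output X
    | some Y => augmentRepeatedly step N Y

theorem CommonIndep.card_le_minRank [Finite E] (hX : CommonIndep M X) : X.card ≤ minRank M := by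
  have card_le : ∀ i, X.card ≤ (M i).eRank.toNat := by
    intro i
    have hle := (hX i).encard_le_eRank
    rw [Set.encard_coe_eq_coe_finsetCard] at hle
    exact ENat.toNat_le_toNat hle ((M i).eRank_ne_top_iff.2 inferInstance)
  exact le_min (card_le 0) (card_le 1)

theorem augmentRepeatedly_spec [Fintype E] {step : Finset E → TwoOracleAlg E (Option (Finset E))}
    {B : ℕ} (hstep : ∀ X, CommonIndep M X →
      IsAugmentation M X ((step X).run M Md) ∧ (step X).cleanCalls M Md ≤ B)
    {N : ℕ} (hX : CommonIndep M X) (hN : Fintype.card E < X.card + N) :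
    IsMaxCommonIndep M ((augmentRepeatedly step N X).run M Md) ∧
      (augmentRepeatedly step N X).cleanCalls M Md ≤ (minRank M - X.card + 1) * B := by
  induction N generalizing X with
  | zero => exact absurd (Finset.card_le_univ X) (by omega)
  | succ N ih =>
    rw [augmentRepeatedly, run_bind, cleanCalls_bind]
    obtain ⟨⟨Y, hrun, hY, hcard⟩ | ⟨hrun, hmax⟩, hcalls⟩ := hstep X hX
    · obtain ⟨hmax, hcalls'⟩ := ih hY (by omega)
      have hrank : minRank M - X.card + 1 = (minRank M - Y.card + 1) + 1 := by
        have := hY.card_le_minRank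
        omega
      rw [hrun, hrank, Nat.succ_mul, add_comm]
      exact ⟨hmax, Nat.add_le_add hcalls' hcalls⟩
    · rw [hrun]
      exact ⟨hmax, hcalls.trans (Nat.le_mul_of_pos_left B (Nat.succ_pos _))⟩

end Iterate

theorem proposition4p2 {E : Type*} [Fintype E] [DecidableEq E] :
    (∃ step : Finset E → TwoOracleAlg E (Option (Finset E)),
      ∀ M Md : Fin 2 → Matroid E, IsInstance M Md →
        ∀ X : Finset E, CommonIndep M X →
          ((∃ Y : Finset E, (step X).run M Md = some Y ∧ CommonIndep M Y ∧
              Y.card = X.card + 1) ∨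
            ((step X).run M Md = none ∧ IsMaxCommonIndep M X)) ∧
          (step X).cleanCalls M Md ≤ stepBound M Md) ∧
    (∃ alg : TwoOracleAlg E (Finset E),
      ∀ M Md : Fin 2 → Matroid E, IsInstance M Md →
        IsMaxCommonIndep M (alg.run M Md) ∧
        alg.cleanCalls M Md ≤ (minRank M + 1) * stepBound M Md) := by
  refine ⟨⟨augmentStep, fun M Md hI X hX => augmentStep_spec hI hX⟩,
    augmentRepeatedly augmentStep (Fintype.card E + 1) ∅, fun M Md hI => ?_⟩
  have hempty : CommonIndep M ∅ := fun i => by simp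
  simpa using augmentRepeatedly_spec (fun X hX => augmentStep_spec hI hX) hempty (by simp)
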